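/- **Setting.** Let $\mathcal G$ be a fixed directed graph on the nodes $\{1,\dots,N\}$ (undirected graphs being the symmetric ones). For a set $A$ of nodes let $\mathcal N(A)$ be the set of nodes outside $A$ that are reached by an edge starting in $A$; put $\mathcal N^{(1)}(i)=\mathcal N(\{i\})$ and $\mathcal N^{(r)}(i)=\mathcal N\{\mathcal N^{(r-1)}(i)\}\setminus\big[\{i\}\cup\bigcup_{q<r}\mathcal N^{(q)}(i)\big]$ for $r\ge 2$. Let $\omega_{i,q,c}\in[0,1]$ ($c=1,\dots,C$) be known connection weights with $\sum_{q\in\mathcal N^{(r)}(i)}\sum_{c=1}^C\omega_{i,q,c}=1$ whenever $r\ge1$ and $\mathcal N^{(r)}(i)\ne\emptyset$. Let $(\mathbf X_t)_{t\in\mathbb Z}$ be a (second-order) stationary $N$-dimensional process that satisfies, for all $t$ and $i$, almost surely, the $\mathrm{GNAR}(p,[\mathbf s])$ equation $$X_{i,t}=\sum_{j=1}^p\Big(\alpha_{i,j}X_{i,t-j}+\sum_{c=1}^C\sum_{r=1}^{s_j}\beta_{j,r,c}\sum_{q\in\mathcal N^{(r)}(i)}\omega_{i,q,c}X_{q,t-j}\Big)+u_{i,t},$$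 where $\alpha_{i,j}=\alpha_{i',j}$ for nodes $i,i'$ of the same class, for a given partition of the nodes into classes (singletons give the general model, one single class gives the global-$\alpha$ model). Write the model as $\mathbf X_t=\phi_1\mathbf X_{t-1}+\dots+\phi_p\mathbf X_{t-p}+\mathbf u_t$, with $\phi_j=\operatorname{diag}\{\alpha_{i,j}\}+\sum_{c}\sum_{r\le s_j}\beta_{j,r,c}W^{(r,c)}$ and $[W^{(r,c)}]_{\ell,m}=\omega_{\ell,m,c}\mathbb I\{m\in\mathcal N^{(r)}(\ell)\}$, and assume that it is stable: $\det(I_N-\phi_1z-\dots-\phi_pz^p)\ne0$ for all complex $|z|\le1$. The innovations $\mathbf u_t$, $t\in\mathbb Z$, are independent over $t$ with mean $0$, nonsingular covariance matrix $\varSigma_u$ (the same for all $t$) and fourth moments bounded uniformly in $t$; the components of $\mathbf u_t$ may be dependent. Let $\boldsymbol\gamma$ be the vector of the $M$ free parameters (the $\alpha$'s of the classes and the $\beta$'s), $B=[\phi_1,\dots,\phi_p]$, and let $R$ be the $pN^2\times M$ matrix, determined by the network, with $\operatorname{vec}(B)=R\boldsymbol\gamma$ for all $\boldsymbol\gamma$,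 where $\operatorname{vec}$ stacks columns. Assume that $R$ has rank $M$. From the observations $\mathbf X_1,\dots,\mathbf X_T$ form $X=[\mathbf X_{p+1},\dots,\mathbf X_T]$ and $Z=[\mathbf Z_p,\dots,\mathbf Z_{T-1}]$, where $\mathbf Z_t$ is the $pN$-vector that stacks $\mathbf X_t,\dots,\mathbf X_{t-p+1}$. **Proposition.** With probability tending to one as $T\to\infty$, the matrix $R'(ZZ'\otimes I_N)R$ is invertible, so that the restricted least squares estimator $$\hat{\boldsymbol\gamma}=\{R'(ZZ'\otimes I_N)R\}^{-1}R'(Z\otimes I_N)\operatorname{vec}(X)$$ is defined. Let $\hat B$ be the matrix with $\operatorname{vec}(\hat B)=R\hat{\boldsymbol\gamma}$. Then $$\tilde\varSigma_u=T^{-1}(X-\hat BZ)(X-\hat BZ)'$$ is a consistent estimator of $\varSigma_u$: $\operatorname{plim}_{T\to\infty}\tilde\varSigma_u=\varSigma_u$. -/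

import Mathlib

open MeasureTheory ProbabilityTheory Filter Topology
open scoped Matrix Kronecker

namespace GNAR

noncomputable section

/-- The neighbour set of a set `A` of nodes: the nodes outside `A` that are reached by an edge
starting in `A`. -/
def nbrs {N : ℕ} (E : Digraph (Fin N)) (A : Finset (Fin N)) : Finset (Fin N) :=
  open Classical in Finset.univ.filter fun j => j ∉ A ∧ ∃ i ∈ A, E.Adj i j

/-- The stage-`r` neighbour set of the node `i`. Stage `0` is `{i}`; stage `r + 1` consists of the
neighbours of stage `r` that belong to none of the stages `0, …, r`. -/
def stageNbrs {N : ℕ} (E : Digraph (Fin N)) (i : Fin N) : ℕ → Finset (Fin N)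
  | 0 => {i}
  | r + 1 => nbrs E (stageNbrs E i r) \
      (Finset.univ : Finset (Fin (r + 1))).biUnion fun q => stageNbrs E i q.1
  decreasing_by all_goals omega

/-- A static network on the nodes `1, …, N` (a directed graph; an undirected one is a symmetric
`Adj`), with connection weights `ω i q c ∈ [0, 1]` for a covariate with `C` values; over the
covariate values and over any non-empty stage-`r` neighbour set the weights sum to one. -/
structure Network (N C : ℕ) where
  graph : Digraph (Fin N)
  ω : Fin N → Fin N → Fin C → ℝ
  ω_mem : ∀ i q c, ω i q c ∈ Set.Icc (0 : ℝ) 1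
  ω_sum : ∀ i r, 1 ≤ r → (stageNbrs graph i r).Nonempty →
    ∑ q ∈ stageNbrs graph i r, ∑ c, ω i q c = 1

/-- The matrix `W^{(r,c)}`, with entries `ω_{ℓ,m,c} 1{m ∈ N^{(r)}(ℓ)}`. -/
def Network.W {N C : ℕ} (net : Network N C) (r : ℕ) (c : Fin C) : Matrix (Fin N) (Fin N) ℝ :=
  open Classical in Matrix.of fun l m => if m ∈ stageNbrs net.graph l r then net.ω l m c else 0

/-- Index type of the unrestricted parameter vector `γ`, of cardinality `G p + C ∑ⱼ sⱼ`.
The entry `inl (a, j)` is the autoregressive coefficient, at lag `j + 1`, of the nodes of class `a`;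
the entry `inr ⟨j, r, c⟩` is the network coefficient `β` at lag `j + 1`, stage `r + 1`,
covariate value `c`. -/
abbrev ParamIdx (p G C : ℕ) (s : Fin p → ℕ) : Type :=
  (Fin G × Fin p) ⊕ ((j : Fin p) × (Fin (s j) × Fin C))

/-- The `N × N` coefficient matrix `φ_{j+1} = diag(α_{i,j+1}) + ∑_c ∑_r β_{j+1,r,c} W^{(r,c)}`,
where `α_{i,j+1}` is the entry of `γ` for the class `cl i` of the node `i`. For `G = N` and
`cl = id` every node has its own coefficients; for `G = 1` this is the global-`α` model. -/
def phi {N C p G : ℕ} (net : Network N C) (s : Fin p → ℕ) (cl : Fin N → Fin G)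
    (γ : ParamIdx p G C s → ℝ) (j : Fin p) : Matrix (Fin N) (Fin N) ℝ :=
  Matrix.diagonal (fun i => γ (Sum.inl (cl i, j))) +
    ∑ c : Fin C, ∑ r : Fin (s j), γ (Sum.inr ⟨j, r, c⟩) • net.W (r.1 + 1) c

/-- The `N × pN` matrix `B = [φ_1, …, φ_p]`. -/
def coeffMatrix {N C p G : ℕ} (net : Network N C) (s : Fin p → ℕ) (cl : Fin N → Fin G)
    (γ : ParamIdx p G C s → ℝ) : Matrix (Fin N) (Fin p × Fin N) ℝ :=
  Matrix.of fun l jm => phi net s cl γ jm.1 l jm.2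

/-- The `pN² × M` constraint matrix `R` that embeds the network structure; see
`vec_coeffMatrix`. -/
def constraintMatrix {N C p G : ℕ} (net : Network N C) (s : Fin p → ℕ) (cl : Fin N → Fin G) :
    Matrix ((Fin p × Fin N) × Fin N) (ParamIdx p G C s) ℝ :=
  Matrix.of fun x y =>
    match y with
    | Sum.inl (a, j) => if x.1.1 = j ∧ x.1.2 = x.2 ∧ cl x.2 = a then 1 else 0
    | Sum.inr ⟨j, r, c⟩ => if x.1.1 = j then net.W (r.1 + 1) c x.2 x.1.2 else 0

/-- The network constraints: `vec B = R γ`. -/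
theorem vec_coeffMatrix {N C p G : ℕ} (net : Network N C) (s : Fin p → ℕ) (cl : Fin N → Fin G)
    (γ : ParamIdx p G C s → ℝ) :
    Matrix.vec (coeffMatrix net s cl γ) = constraintMatrix net s cl *ᵥ γ := by
  funext x
  obtain ⟨⟨j, m⟩, l⟩ := x
  simp only [Matrix.vec, coeffMatrix, phi, constraintMatrix, Matrix.mulVec, dotProduct,
    Matrix.of_apply, Matrix.add_apply, Fintype.sum_sum_type, Fintype.sum_prod_type,
    Fintype.sum_sigma, Matrix.sum_apply, Matrix.smul_apply, smul_eq_mul, Matrix.diagonal_apply]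
  congr 1
  · rw [Finset.sum_eq_single (cl l), Finset.sum_eq_single j]
    · by_cases h : l = m
      · subst h; simp
      · simp [h, Ne.symm h]
    · intro b _ hb; simp [Ne.symm hb]
    · simp
    · intro b _ hb; simp [Ne.symm hb]
    · simp
  · rw [Finset.sum_eq_single j]
    · rw [Finset.sum_comm]; simp [mul_comm]
    · intro b _ hb; simp [Ne.symm hb]
    · simp

/-- Stability of the vector autoregression with coefficient matrices `φ_1, …, φ_p`:
`det (I - φ_1 z - ⋯ - φ_p z^p) ≠ 0` for all complex `z` with `|z| ≤ 1`. -/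
def IsStable {N p : ℕ} (φ : Fin p → Matrix (Fin N) (Fin N) ℝ) : Prop :=
  ∀ z : ℂ, ‖z‖ ≤ 1 →
    (1 - ∑ j : Fin p, z ^ (j.1 + 1) • (φ j).map (fun a : ℝ => (a : ℂ))).det ≠ 0

/-- (Second-order) stationarity of a vector process indexed by the integers. -/
structure IsStationary {N : ℕ} {Ω : Type*} [MeasurableSpace Ω] (μ : Measure Ω)
    (X : ℤ → Ω → Fin N → ℝ) : Prop where
  measurable : ∀ t, Measurable (X t)
  memLp : ∀ t i, MemLp (fun w => X t w i) 2 μ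
  mean : ∀ t i, ∫ w, X t w i ∂μ = ∫ w, X 0 w i ∂μ
  cov : ∀ t h i k, covariance (fun w => X (t + h) w i) (fun w => X t w k) μ =
    covariance (fun w => X h w i) (fun w => X 0 w k) μ

/-- Independent white noise with bounded fourth moments and covariance matrix `S`: the vectors
`u_t` are independent for different `t`, and have mean `0`, covariance `S` and fourth moments
bounded uniformly in `t`. (For identically distributed `u_t` the bound just says that the fourth
moments are finite.) The components of a single `u_t` may be dependent. -/
structure IsIndepWhiteNoise {N : ℕ} {Ω : Type*} [MeasurableSpace Ω] (μ : Measure Ω)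
    (u : ℤ → Ω → Fin N → ℝ) (S : Matrix (Fin N) (Fin N) ℝ) : Prop where
  measurable : ∀ t, Measurable (u t)
  indep : iIndepFun u μ
  memLp : ∀ t i, MemLp (fun w => u t w i) 4 μ
  bound : ∃ K : ℝ, ∀ t i, ∫ w, (u t w i) ^ 4 ∂μ ≤ K
  mean : ∀ t i, ∫ w, u t w i ∂μ = 0
  cov : ∀ t i k, ∫ w, u t w i * u t w k ∂μ = S i k

/-- `X` is a stationary `GNAR(p, [s])` process over the static network `net`, with parameters `γ`
and innovations `u`: it solves the model equation at every node and time, it is stationary, and the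
autoregression is stable. -/
structure IsStationaryGNAR {N C p G : ℕ} (net : Network N C) (s : Fin p → ℕ) (cl : Fin N → Fin G)
    (γ : ParamIdx p G C s → ℝ) {Ω : Type*} [MeasurableSpace Ω] (μ : Measure Ω)
    (X u : ℤ → Ω → Fin N → ℝ) : Prop where
  eqn : ∀ t i, ∀ᵐ w ∂μ, X t w i =
    ∑ j : Fin p, (γ (Sum.inl (cl i, j)) * X (t - (j.1 + 1 : ℕ)) w i +
      ∑ c : Fin C, ∑ r : Fin (s j), γ (Sum.inr ⟨j, r, c⟩) *
        ∑ q ∈ stageNbrs net.graph i (r.1 + 1), net.ω i q c * X (t - (j.1 + 1 : ℕ)) w q) +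
    u t w i
  stationary : IsStationary μ X
  stable : IsStable (phi net s cl γ)

/-- The data matrix `X = [X_{p+1}, …, X_T]`, from a sample path `x`. -/
def dataX {N : ℕ} (p T : ℕ) (x : ℤ → Fin N → ℝ) : Matrix (Fin N) (Fin (T - p)) ℝ :=
  Matrix.of fun i k => x ((p : ℤ) + 1 + k.1) i

/-- The regressor matrix `Z = [Z_p, …, Z_{T-1}]`, where `Z_t` stacks `X_t, …, X_{t-p+1}`. -/
def dataZ {N : ℕ} (p T : ℕ) (x : ℤ → Fin N → ℝ) : Matrix (Fin p × Fin N) (Fin (T - p)) ℝ :=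
  Matrix.of fun jm k => x ((p : ℤ) + k.1 - jm.1.1) jm.2

/-- The matrix `R' (Z Z' ⊗ I_N) R`. -/
def normalMatrix {N C p G : ℕ} (net : Network N C) (s : Fin p → ℕ) (cl : Fin N → Fin G)
    (T : ℕ) (x : ℤ → Fin N → ℝ) : Matrix (ParamIdx p G C s) (ParamIdx p G C s) ℝ :=
  (constraintMatrix net s cl)ᵀ *
    ((dataZ p T x * (dataZ p T x)ᵀ) ⊗ₖ (1 : Matrix (Fin N) (Fin N) ℝ)) * constraintMatrix net s cl

/-- The restricted least squares estimator
`γ̂ = {R' (Z Z' ⊗ I_N) R}⁻¹ R' (Z ⊗ I_N) vec X`. -/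
def gammaHat {N C p G : ℕ} (net : Network N C) (s : Fin p → ℕ) (cl : Fin N → Fin G)
    (T : ℕ) (x : ℤ → Fin N → ℝ) : ParamIdx p G C s → ℝ :=
  (normalMatrix net s cl T x)⁻¹ *ᵥ ((constraintMatrix net s cl)ᵀ *ᵥ
    ((dataZ p T x ⊗ₖ (1 : Matrix (Fin N) (Fin N) ℝ)) *ᵥ Matrix.vec (dataX p T x)))

/-- The residual-based estimator `T⁻¹ (X - B̂ Z) (X - B̂ Z)'`, where `vec B̂ = R γ̂`. -/
def sigmaTilde {N C p G : ℕ} (net : Network N C) (s : Fin p → ℕ) (cl : Fin N → Fin G)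
    (T : ℕ) (x : ℤ → Fin N → ℝ) : Matrix (Fin N) (Fin N) ℝ :=
  (T : ℝ)⁻¹ •
    ((dataX p T x - coeffMatrix net s cl (gammaHat net s cl T x) * dataZ p T x) *
      (dataX p T x - coeffMatrix net s cl (gammaHat net s cl T x) * dataZ p T x)ᵀ)

end

end GNAR

namespace GNAR

/-! Let `U` hold the innovations and `D = B̂ - B`. The residual matrix is `U - D Z`, so the
estimator is `T⁻¹ U U'` plus terms built from `D`, `T⁻¹ U Z'` and `T⁻¹ Z Z'`. It is enough that
these three moments converge in probability to `Σ_u`, `0` and a positive definite `Γ`: the normal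
matrix, scaled by `T⁻¹`, then tends to the positive definite `R' (Γ ⊗ I) R`, and `D → 0`.

The first two limits are weak laws for orthogonal sequences. For `U Z'` orthogonality holds because
stability makes the process a function of present and past innovations
(`aestronglyMeasurable_past_lagVec`). The third limit needs no law of large numbers for products of
observations: in companion form `Z_{t+1} = A Z_t + F u_{t+1}` the Gram sums telescope, so `S = T⁻¹ Z
Z'` satisfies `S - A S A' = F (T⁻¹ U U') F' + o(1)` (`IsPath.lyapunov`). Since `A ^ k → 0`, the map
`S ↦ S - A S A'` is invertible, and `S` converges (`exists_tendsto_of_lyapunov`).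

Convergence in probability is convergence along a single filter, `probFilter`, so continuity
arguments apply to it directly. -/

/-! ### Companion form and decay of its powers. -/

/-- The companion matrix of the autoregression with coefficient matrices `φ`. -/
def companion {N p : ℕ} {R : Type*} [Semiring R] (φ : Fin p → Matrix (Fin N) (Fin N) R) :
    Matrix (Fin p × Fin N) (Fin p × Fin N) R :=
  Matrix.of fun a b =>
    if a.1.1 = 0 then φ b.1 a.2 b.2 else if b.1.1 + 1 = a.1.1 ∧ a.2 = b.2 then 1 else 0

/-- The matrix `(I, 0, …, 0)'` that embeds an `N`-vector as the first block of a `pN`-vector. -/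
def firstBlock (N p : ℕ) : Matrix (Fin p × Fin N) (Fin N) ℝ :=
  Matrix.of fun a i => if a.1.1 = 0 ∧ a.2 = i then 1 else 0

theorem companion_map {N p : ℕ} (φ : Fin p → Matrix (Fin N) (Fin N) ℝ) :
    (companion φ).map (algebraMap ℝ ℂ) =
      companion fun j => (φ j).map (fun a : ℝ => (a : ℂ)) := by
  ext a b
  simp only [companion, Matrix.map_apply, Matrix.of_apply]
  split_ifs <;> simp

theorem companion_mulVec_zero {N p : ℕ} {R : Type*} [Semiring R]
    (φ : Fin p → Matrix (Fin N) (Fin N) R) (v : Fin p × Fin N → R) (h : 0 < p) (m : Fin N) :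
    (companion φ *ᵥ v) (⟨0, h⟩, m) = ∑ j, (φ j *ᵥ fun l => v (j, l)) m := by
  simp [companion, Matrix.mulVec, dotProduct, Fintype.sum_prod_type]

theorem companion_mulVec_succ {N p : ℕ} {R : Type*} [Semiring R]
    (φ : Fin p → Matrix (Fin N) (Fin N) R) (v : Fin p × Fin N → R) (j : ℕ) (h : j + 1 < p)
    (m : Fin N) :
    (companion φ *ᵥ v) (⟨j + 1, h⟩, m) = v (⟨j, by omega⟩, m) := by
  simp only [companion, Matrix.mulVec, dotProduct, Matrix.of_apply]
  rw [Finset.sum_eq_single (⟨j, by omega⟩, m)]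
  · simp
  · rintro ⟨b, l⟩ - hb
    have : ¬ (b.1 = j ∧ m = l) := by
      rintro ⟨h1, h2⟩
      exact hb (Prod.ext (Fin.ext h1) h2.symm)
    simp [this]
  · simp

theorem firstBlock_mulVec_zero {N p : ℕ} (v : Fin N → ℝ) (h : 0 < p) (m : Fin N) :
    (firstBlock N p *ᵥ v) (⟨0, h⟩, m) = v m := by
  simp [firstBlock, Matrix.mulVec, dotProduct]

theorem firstBlock_mulVec_succ {N p : ℕ} (v : Fin N → ℝ) (j : ℕ) (h : j + 1 < p) (m : Fin N) :
    (firstBlock N p *ᵥ v) (⟨j + 1, h⟩, m) = 0 := by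
  simp [firstBlock, Matrix.mulVec, dotProduct]

/-- An eigenvector of the companion matrix with a non-zero eigenvalue yields a kernel vector of the
characteristic polynomial of the autoregression. -/
theorem norm_lt_one_of_mem_spectrum_companion {N p : ℕ} {φ : Fin p → Matrix (Fin N) (Fin N) ℝ}
    (hφ : IsStable φ) {z : ℂ} (hz : z ∈ spectrum ℂ ((companion φ).map (algebraMap ℝ ℂ))) :
    ‖z‖ < 1 := by
  by_contra! h1
  have hz0 : z ≠ 0 := by
    rintro rfl
    simp at h1
    linarith
  rw [companion_map, spectrum.mem_iff, Matrix.isUnit_iff_isUnit_det, isUnit_iff_ne_zero,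
    not_not, ← Matrix.exists_mulVec_eq_zero_iff] at hz
  obtain ⟨v, hv0, hv⟩ := hz
  set ψ : Fin p → Matrix (Fin N) (Fin N) ℂ := fun j => (φ j).map (fun a : ℝ => (a : ℂ)) with hψ
  have heig : ∀ a, (companion ψ *ᵥ v) a = z * v a := by
    intro a
    have := congrFun hv a
    rw [Matrix.sub_mulVec, Algebra.algebraMap_eq_smul_one, Matrix.smul_mulVec, Matrix.one_mulVec,
      Pi.sub_apply, Pi.smul_apply, smul_eq_mul, Pi.zero_apply, sub_eq_zero] at this
    exact this.symm
  rcases Nat.eq_zero_or_pos p with rfl | hp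
  · exact hv0 (funext fun a => a.1.elim0)
  -- The lower block rows of the companion matrix only shift, so an eigenvector is determined by its
  -- block `0`.
  have hpow : ∀ (j : ℕ) (hj : j < p) (m : Fin N), v (⟨j, hj⟩, m) = z⁻¹ ^ j * v (⟨0, hp⟩, m) := by
    intro j
    induction j with
    | zero => intro hj m; simp
    | succ j ih =>
      intro hj m
      have := heig (⟨j + 1, hj⟩, m)
      rw [companion_mulVec_succ, ih] at this
      rw [pow_succ', mul_assoc, this, inv_mul_cancel_left₀ hz0]
  -- This is the first block row of the eigenvalue equation, divided by `z`; stability applies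
  -- because `z⁻¹` lies in the closed unit disc.
  have hker : (1 - ∑ j : Fin p, z⁻¹ ^ (j.1 + 1) • ψ j) *ᵥ (fun m => v (⟨0, hp⟩, m)) = 0 := by
    funext m
    have h0 := heig (⟨0, hp⟩, m)
    rw [companion_mulVec_zero] at h0
    rw [Matrix.sub_mulVec, Matrix.one_mulVec, Pi.sub_apply, Pi.zero_apply, sub_eq_zero,
      Matrix.sum_mulVec, Finset.sum_apply]
    have h2 : ∀ j : Fin p, (ψ j *ᵥ fun l => v (j, l)) m =
        z * ((z⁻¹ ^ (j.1 + 1) • ψ j) *ᵥ fun m => v (⟨0, hp⟩, m)) m := by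
      intro j
      have : (fun l => v (j, l)) = z⁻¹ ^ j.1 • fun l => v (⟨0, hp⟩, l) := by
        funext l
        simpa using hpow j.1 j.2 l
      rw [this, Matrix.mulVec_smul, Matrix.smul_mulVec, Pi.smul_apply, Pi.smul_apply, smul_eq_mul,
        smul_eq_mul, ← mul_assoc, pow_succ', mul_inv_cancel_left₀ hz0]
    rw [Finset.sum_congr rfl fun j _ => h2 j, ← Finset.mul_sum] at h0
    exact (mul_left_cancel₀ hz0 h0).symm
  have hdet := hφ z⁻¹ (by rw [norm_inv]; exact inv_le_one_of_one_le₀ h1)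
  have hw : (fun m => v (⟨0, hp⟩, m)) = 0 := by
    by_contra hw
    exact hdet (Matrix.exists_mulVec_eq_zero_iff.1 ⟨_, hw, hker⟩)
  refine hv0 (funext fun a => ?_)
  obtain ⟨⟨j, hj⟩, m⟩ := a
  rw [hpow j hj m, congrFun hw m]
  simp

/-- By Gelfand's formula, `‖a ^ n‖ ≤ r ^ n` eventually, for any `r` strictly between the spectral
radius and `1`. -/
theorem tendsto_pow_of_spectralRadius_lt_one {A : Type*} [NormedRing A] [NormedAlgebra ℂ A]
    [CompleteSpace A] {a : A} (ha : spectralRadius ℂ a < 1) :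
    Tendsto (fun n : ℕ => a ^ n) atTop (𝓝 0) := by
  obtain ⟨r, hr, hr1⟩ := ENNReal.lt_iff_exists_nnreal_btwn.1 ha
  have h := (spectrum.pow_nnnorm_pow_one_div_tendsto_nhds_spectralRadius a).eventually_lt_const hr
  have hr1' : r < 1 := by exact_mod_cast hr1
  refine squeeze_zero_norm' (a := fun n => (r : ℝ) ^ n) ?_
    (tendsto_pow_atTop_nhds_zero_of_lt_one r.2 hr1')
  filter_upwards [h, eventually_gt_atTop 0] with n hn hn0
  have h2 : (‖a ^ n‖₊ : ENNReal) ≤ (r : ENNReal) ^ n := by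
    have := ENNReal.rpow_le_rpow hn.le (Nat.cast_nonneg (α := ℝ) n)
    rwa [← ENNReal.rpow_mul, one_div, inv_mul_cancel₀ (by positivity), ENNReal.rpow_one,
      ENNReal.rpow_natCast] at this
  have h3 : ‖a ^ n‖₊ ≤ r ^ n := by exact_mod_cast h2
  exact_mod_cast h3

section

attribute [local instance] Matrix.linftyOpNormedRing Matrix.linftyOpNormedAlgebra

/-- The operator norm serves only to make the matrices a Banach algebra; the limit itself is
entrywise. The trivial algebra is split off because its spectrum is empty. -/
theorem tendsto_matrix_pow_of_spectrum {n : Type*} [Fintype n] [DecidableEq n]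
    {A : Matrix n n ℂ} (hA : ∀ z ∈ spectrum ℂ A, ‖z‖ < 1) :
    Tendsto (fun k : ℕ => A ^ k) atTop (𝓝 0) := by
  rcases subsingleton_or_nontrivial (Matrix n n ℂ) with h | h
  · exact tendsto_const_nhds.congr fun k => Subsingleton.elim _ _
  · have : CompleteSpace (Matrix n n ℂ) := FiniteDimensional.complete ℂ _
    refine tendsto_pow_of_spectralRadius_lt_one ?_
    exact spectrum.spectralRadius_lt_of_forall_lt A (r := 1) fun z hz => by
      exact_mod_cast hA z hz

end

/-- The powers of the companion matrix of a stable autoregression tend to zero. -/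
theorem IsStable.tendsto_companion_pow {N p : ℕ} {φ : Fin p → Matrix (Fin N) (Fin N) ℝ}
    (hφ : IsStable φ) : Tendsto (fun k : ℕ => companion φ ^ k) atTop (𝓝 0) := by
  have h := tendsto_matrix_pow_of_spectrum fun z hz => norm_lt_one_of_mem_spectrum_companion hφ hz
  have hre : Continuous fun M : Matrix (Fin p × Fin N) (Fin p × Fin N) ℂ => M.map Complex.re :=
    Continuous.matrix_map continuous_id Complex.continuous_re
  have h2 := (hre.tendsto _).comp h
  refine (h2.congr fun k => ?_).trans (by simp)
  ext a b
  rw [Function.comp_apply, ← Matrix.map_pow]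
  simp

/-! ### The Lyapunov equation. -/

section Lyapunov

variable {n ι : Type*} [Fintype n] [DecidableEq n]

/-- Iteration gives `D = A ^ k D (A ^ k)'`, whose right side tends to zero. -/
theorem eq_zero_of_eq_mul_mul_transpose {A D : Matrix n n ℝ}
    (hA : Tendsto (fun k : ℕ => A ^ k) atTop (𝓝 0)) (hD : D = A * D * Aᵀ) : D = 0 := by
  have h : ∀ k : ℕ, D = A ^ k * D * (A ^ k)ᵀ := by
    intro k
    induction k with
    | zero => simp
    | succ k ih =>
      calc D = A * (A ^ k * D * (A ^ k)ᵀ) * Aᵀ := by rw [← ih]; exact hD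
        _ = _ := by simp only [pow_succ' A k, Matrix.transpose_mul, Matrix.mul_assoc]
  have hc : Continuous fun M : Matrix n n ℝ => M * D * Mᵀ := by fun_prop
  have h2 := (hc.tendsto 0).comp hA
  have h3 : Tendsto (fun _ : ℕ => D) atTop (𝓝 0) := by
    refine (h2.congr fun k => ?_).trans (by simp)
    exact (h k).symm
  exact tendsto_nhds_unique tendsto_const_nhds h3

/-- Stability of the Lyapunov equation `S = A S A' + Q`. -/
theorem exists_tendsto_of_lyapunov {A Q : Matrix n n ℝ}
    (hA : Tendsto (fun k : ℕ => A ^ k) atTop (𝓝 0)) {l : Filter ι} {S : ι → Matrix n n ℝ}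
    (hS : Tendsto (fun x => S x - A * S x * Aᵀ) l (𝓝 Q)) :
    ∃ Γ, Γ = A * Γ * Aᵀ + Q ∧ Tendsto S l (𝓝 Γ) := by
  let f : Matrix n n ℝ →ₗ[ℝ] Matrix n n ℝ :=
    { toFun := fun M => M - A * M * Aᵀ
      map_add' := fun M M' => by rw [Matrix.mul_add, Matrix.add_mul]; abel
      map_smul' := fun c M => by
        simp only [Matrix.mul_smul, Matrix.smul_mul, RingHom.id_apply, smul_sub] }
  -- In finite dimension an injective endomorphism is invertible with continuous inverse, so
  -- convergence of `f (S x)` forces convergence of `S x`.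
  have hf : Function.Injective f := by
    rw [injective_iff_map_eq_zero]
    intro M hM
    exact eq_zero_of_eq_mul_mul_transpose hA (sub_eq_zero.1 hM)
  let e := LinearEquiv.ofInjectiveEndo f hf
  have he : ∀ M, e M = M - A * M * Aᵀ := fun M => rfl
  refine ⟨e.symm Q, ?_, ?_⟩
  · have := he (e.symm Q)
    rw [LinearEquiv.apply_symm_apply] at this
    rw [eq_sub_iff_add_eq] at this
    rw [add_comm]
    exact this.symm
  · have hc : Continuous e.symm := LinearMap.continuous_of_finiteDimensional e.symm.toLinearMap
    refine ((hc.tendsto Q).comp hS).congr fun x => ?_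
    rw [Function.comp_apply, ← he, LinearEquiv.symm_apply_apply]

end Lyapunov

theorem dotProduct_mul_mul_transpose_mulVec {m n : Type*} [Fintype m] [Fintype n]
    (A : Matrix m n ℝ) (M : Matrix n n ℝ) (v : m → ℝ) :
    v ⬝ᵥ ((A * M * Aᵀ) *ᵥ v) = (Aᵀ *ᵥ v) ⬝ᵥ (M *ᵥ (Aᵀ *ᵥ v)) := by
  rw [← Matrix.mulVec_mulVec, ← Matrix.mulVec_mulVec, Matrix.dotProduct_mulVec,
    Matrix.mulVec_transpose]

/-- A positive semidefinite solution of the Lyapunov equation of the companion matrix, with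
nondegenerate innovations in the first block, is positive definite. -/
theorem posDef_of_companion_lyapunov {N p : ℕ} {φ : Fin p → Matrix (Fin N) (Fin N) ℝ}
    {Γ : Matrix (Fin p × Fin N) (Fin p × Fin N) ℝ} {Q : Matrix (Fin N) (Fin N) ℝ}
    (hΓ : Γ.PosSemidef) (hQ : Q.PosDef)
    (h : Γ = companion φ * Γ * (companion φ)ᵀ + firstBlock N p * Q * (firstBlock N p)ᵀ) :
    Γ.PosDef := by
  have hnn : ∀ v, 0 ≤ v ⬝ᵥ (Γ *ᵥ v) := fun v => by simpa using hΓ.dotProduct_mulVec_nonneg v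
  -- Both summands of `v' Γ v` are nonnegative, so the null vectors of `Γ` have vanishing first
  -- block and are preserved by `A'`.
  have hstep : ∀ v, v ⬝ᵥ (Γ *ᵥ v) = 0 → (firstBlock N p)ᵀ *ᵥ v = 0 ∧
      ((companion φ)ᵀ *ᵥ v) ⬝ᵥ (Γ *ᵥ ((companion φ)ᵀ *ᵥ v)) = 0 := by
    intro v hv
    rw [h, Matrix.add_mulVec, dotProduct_add, dotProduct_mul_mul_transpose_mulVec,
      dotProduct_mul_mul_transpose_mulVec] at hv
    have h1 := hnn ((companion φ)ᵀ *ᵥ v)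
    have h2 : 0 ≤ ((firstBlock N p)ᵀ *ᵥ v) ⬝ᵥ (Q *ᵥ ((firstBlock N p)ᵀ *ᵥ v)) := by
      simpa using hQ.posSemidef.dotProduct_mulVec_nonneg ((firstBlock N p)ᵀ *ᵥ v)
    refine ⟨?_, by linarith⟩
    by_contra hne
    have := hQ.dotProduct_mulVec_pos hne
    rw [star_trivial] at this
    linarith
  have hfirst : ∀ v, (firstBlock N p)ᵀ *ᵥ v = 0 → ∀ (hp : 0 < p) m, v (⟨0, hp⟩, m) = 0 := by
    intro v hv hp m
    have := congrFun hv m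
    simp only [firstBlock, Matrix.mulVec, dotProduct, Matrix.transpose_apply, Matrix.of_apply,
      Pi.zero_apply] at this
    rw [Finset.sum_eq_single (⟨0, hp⟩, m)] at this
    · simpa using this
    · rintro ⟨b, l⟩ - hb
      have : ¬ (b.1 = 0 ∧ l = m) := by
        rintro ⟨h1, h2⟩
        exact hb (Prod.ext (Fin.ext h1) h2)
      simp [this]
    · simp
  -- When block `0` of `v` vanishes, `A'` moves block `j + 1` to block `j`. The induction quantifies
  -- over all null vectors because it is applied to `A' v`.
  have hall : ∀ (j : ℕ) (hj : j < p) v, v ⬝ᵥ (Γ *ᵥ v) = 0 → ∀ m, v (⟨j, hj⟩, m) = 0 := by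
    intro j
    induction j with
    | zero => exact fun hj v hv m => hfirst v (hstep v hv).1 hj m
    | succ j ih =>
      intro hj v hv m
      have h0 := ih (by omega) _ (hstep v hv).2 m
      have hz := hfirst v (hstep v hv).1 (by omega)
      simp only [companion, Matrix.mulVec, dotProduct, Matrix.transpose_apply,
        Matrix.of_apply] at h0
      rw [Finset.sum_eq_single (⟨j + 1, hj⟩, m)] at h0
      · simpa using h0
      · rintro ⟨⟨b, hb⟩, l⟩ - hne
        rcases Nat.eq_zero_or_pos b with rfl | hb0
        · simp [hz l]
        · have : ¬ (j + 1 = b ∧ l = m) := by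
            rintro ⟨rfl, rfl⟩
            exact hne rfl
          simp [this, hb0.ne']
      · simp
  refine Matrix.PosDef.of_dotProduct_mulVec_pos hΓ.1 fun v hv => ?_
  rw [star_trivial]
  refine lt_of_le_of_ne (hnn v) fun h0 => hv (funext fun a => ?_)
  exact hall a.1.1 a.1.2 v h0.symm a.2

/-! ### Restricted least squares, given limits of the sample moments. -/

theorem mulVec_injective_of_rank_eq_card {m n : Type*} [Fintype m] [Fintype n] {R : Matrix m n ℝ}
    (hR : R.rank = Fintype.card n) : Function.Injective R.mulVec := by
  have h := LinearMap.finrank_range_add_finrank_ker R.mulVecLin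
  rw [Module.finrank_fintype_fun_eq_card] at h
  have h0 : Module.finrank ℝ (LinearMap.ker R.mulVecLin) = 0 := by
    have : Module.finrank ℝ (LinearMap.range R.mulVecLin) = Fintype.card n := hR
    omega
  rw [Submodule.finrank_eq_zero, LinearMap.ker_eq_bot] at h0
  exact h0

theorem continuousAt_matrix_inv_of_posDef {n : Type*} [Fintype n] [DecidableEq n]
    {Q : Matrix n n ℝ} (hQ : Q.PosDef) : ContinuousAt Inv.inv Q := by
  refine continuousAt_matrix_inv Q ?_
  rw [Ring.inverse_eq_inv']
  exact continuousAt_inv₀ hQ.det_pos.ne'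

theorem continuous_vec {m n : Type*} :
    Continuous (Matrix.vec : Matrix m n ℝ → n × m → ℝ) :=
  continuous_pi fun a => (continuous_id.matrix_elem a.2 a.1)

section

variable {N C p G : ℕ} (net : Network N C) (s : Fin p → ℕ) (cl : Fin N → Fin G)

theorem continuous_coeffMatrix : Continuous (coeffMatrix net s cl) := by
  refine continuous_matrix fun i j => ?_
  have h : ∀ γ, coeffMatrix net s cl γ i j = (constraintMatrix net s cl *ᵥ γ) (j, i) := fun γ => by
    rw [← vec_coeffMatrix]
    rfl
  simp only [h]
  exact (continuous_apply (j, i)).comp (Continuous.matrix_mulVec continuous_const continuous_id)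

/-- The identity `(Z ⊗ I) vec X = vec (X Z')` splits the normal equations into a signal part,
reproducing `γ` exactly, and an error governed by `U Z'`. -/
theorem gammaHat_eq_of_isUnit {T : ℕ} {x : ℤ → Fin N → ℝ} {γ : ParamIdx p G C s → ℝ}
    {U : Matrix (Fin N) (Fin (T - p)) ℝ} (hU : IsUnit (normalMatrix net s cl T x))
    (hx : dataX p T x = coeffMatrix net s cl γ * dataZ p T x + U) :
    gammaHat net s cl T x = γ + (normalMatrix net s cl T x)⁻¹ *ᵥ
      ((constraintMatrix net s cl)ᵀ *ᵥ Matrix.vec (U * (dataZ p T x)ᵀ)) := by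
  have h1 : (dataZ p T x ⊗ₖ (1 : Matrix (Fin N) (Fin N) ℝ)) *ᵥ Matrix.vec (dataX p T x) =
      ((dataZ p T x * (dataZ p T x)ᵀ) ⊗ₖ (1 : Matrix (Fin N) (Fin N) ℝ)) *ᵥ
        (constraintMatrix net s cl *ᵥ γ) + Matrix.vec (U * (dataZ p T x)ᵀ) := by
    rw [← vec_coeffMatrix, Matrix.kronecker_mulVec_vec, Matrix.kronecker_mulVec_vec, hx,
      Matrix.one_mul, Matrix.one_mul, Matrix.add_mul, Matrix.vec_add, Matrix.transpose_mul,
      Matrix.transpose_transpose, Matrix.mul_assoc]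
  rw [gammaHat, h1, Matrix.mulVec_add, Matrix.mulVec_add]
  congr 1
  have h2 : (constraintMatrix net s cl)ᵀ *ᵥ
      (((dataZ p T x * (dataZ p T x)ᵀ) ⊗ₖ (1 : Matrix (Fin N) (Fin N) ℝ)) *ᵥ
        (constraintMatrix net s cl *ᵥ γ)) = normalMatrix net s cl T x *ᵥ γ := by
    rw [normalMatrix, ← Matrix.mulVec_mulVec, ← Matrix.mulVec_mulVec]
  rw [h2, Matrix.mulVec_mulVec, Matrix.nonsing_inv_mul _
    ((Matrix.isUnit_iff_isUnit_det _).1 hU), Matrix.one_mulVec]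

theorem residual_mul_transpose {m n k : Type*} [Fintype m] [Fintype n] [Fintype k]
    (c : ℝ) (U : Matrix m k ℝ) (D : Matrix m n ℝ) (Z : Matrix n k ℝ) :
    c • ((U - D * Z) * (U - D * Z)ᵀ) =
      c • (U * Uᵀ) - (c • (U * Zᵀ)) * Dᵀ - D * (c • (U * Zᵀ))ᵀ + D * (c • (Z * Zᵀ)) * Dᵀ := by
  simp only [Matrix.transpose_sub, Matrix.transpose_mul, Matrix.sub_mul, Matrix.mul_sub,
    Matrix.transpose_smul, Matrix.transpose_transpose, Matrix.mul_smul, Matrix.smul_mul,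
    Matrix.mul_assoc, smul_sub]
  abel

/-- Consistency of restricted least squares and of the residual covariance along an arbitrary
filter, from the limits of the sample second moments. -/
theorem isUnit_normalMatrix_and_tendsto_sigmaTilde {γ : ParamIdx p G C s → ℝ}
    (hR : (constraintMatrix net s cl).rank = Fintype.card (ParamIdx p G C s))
    {ι : Type*} {l : Filter ι} {T : ι → ℕ} (hT : Tendsto T l atTop) {x : ι → ℤ → Fin N → ℝ}
    {U : ∀ a, Matrix (Fin N) (Fin (T a - p)) ℝ}
    (hx : ∀ᶠ a in l,
      dataX p (T a) (x a) = coeffMatrix net s cl γ * dataZ p (T a) (x a) + U a)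
    {Γ : Matrix (Fin p × Fin N) (Fin p × Fin N) ℝ} (hΓ : Γ.PosDef)
    (hS : Tendsto (fun a => (T a : ℝ)⁻¹ • (dataZ p (T a) (x a) * (dataZ p (T a) (x a))ᵀ)) l (𝓝 Γ))
    (hC : Tendsto (fun a => (T a : ℝ)⁻¹ • (U a * (dataZ p (T a) (x a))ᵀ)) l (𝓝 0))
    {Q : Matrix (Fin N) (Fin N) ℝ}
    (hV : Tendsto (fun a => (T a : ℝ)⁻¹ • (U a * (U a)ᵀ)) l (𝓝 Q)) :
    (∀ᶠ a in l, IsUnit (normalMatrix net s cl (T a) (x a))) ∧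
      Tendsto (fun a => sigmaTilde net s cl (T a) (x a)) l (𝓝 Q) := by
  set R := constraintMatrix net s cl with hRdef
  let F : Matrix (Fin p × Fin N) (Fin p × Fin N) ℝ → Matrix (ParamIdx p G C s) _ ℝ := fun S =>
    Rᵀ * (S ⊗ₖ (1 : Matrix (Fin N) (Fin N) ℝ)) * R
  have hFc : Continuous F := by
    have : Continuous fun S : Matrix (Fin p × Fin N) (Fin p × Fin N) ℝ =>
        S ⊗ₖ (1 : Matrix (Fin N) (Fin N) ℝ) := by
      refine continuous_matrix fun i j => ?_
      simp only [Matrix.kroneckerMap_apply]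
      exact (continuous_id.matrix_elem _ _).mul continuous_const
    exact (continuous_const.matrix_mul this).matrix_mul continuous_const
  -- Full column rank makes `R` injective, so the congruence keeps `Γ ⊗ I` positive definite.
  have hQ : (F Γ).PosDef := by
    have := (hΓ.kronecker (Matrix.PosDef.one (n := Fin N) (R := ℝ))).conjTranspose_mul_mul_same
      (mulVec_injective_of_rank_eq_card hR)
    rwa [Matrix.conjTranspose_eq_transpose_of_trivial] at this
  have hFlim := (hFc.tendsto Γ).comp hS
  have hF : ∀ a, F ((T a : ℝ)⁻¹ • (dataZ p (T a) (x a) * (dataZ p (T a) (x a))ᵀ)) =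
      (T a : ℝ)⁻¹ • normalMatrix net s cl (T a) (x a) := by
    intro a
    simp only [F, normalMatrix, Matrix.smul_kronecker, Matrix.mul_smul, Matrix.smul_mul, R]
  have hlim : Tendsto (fun a => (T a : ℝ)⁻¹ • normalMatrix net s cl (T a) (x a)) l (𝓝 (F Γ)) :=
    hFlim.congr hF
  have hTpos : ∀ᶠ a in l, 0 < T a := hT.eventually (eventually_gt_atTop 0)
  have hunit : ∀ᶠ a in l, IsUnit (normalMatrix net s cl (T a) (x a)) := by
    have hdet := ((continuous_id.matrix_det).tendsto (F Γ)).comp hlim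
    filter_upwards [hdet.eventually_ne hQ.det_pos.ne'] with a ha
    rw [Matrix.isUnit_iff_isUnit_det, isUnit_iff_ne_zero]
    intro h0
    simp [h0] at ha
  refine ⟨hunit, ?_⟩
  have hinv := (continuousAt_matrix_inv_of_posDef hQ).tendsto.comp hlim
  have hvec := (continuous_vec.tendsto _).comp hC
  have hdiff : Tendsto (fun a => ((T a : ℝ)⁻¹ • normalMatrix net s cl (T a) (x a))⁻¹ *ᵥ
      (Rᵀ *ᵥ Matrix.vec ((T a : ℝ)⁻¹ • (U a * (dataZ p (T a) (x a))ᵀ)))) l (𝓝 0) := by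
    have hc : Continuous fun q : Matrix (ParamIdx p G C s) (ParamIdx p G C s) ℝ ×
        ((Fin p × Fin N) × Fin N → ℝ) => q.1 *ᵥ (Rᵀ *ᵥ q.2) := by fun_prop
    have := (hc.tendsto _).comp (hinv.prodMk_nhds hvec)
    simp only [Matrix.vec_zero, Matrix.mulVec_zero] at this
    exact this
  have hγ : Tendsto (fun a => gammaHat net s cl (T a) (x a)) l (𝓝 γ) := by
    have h1 := hdiff.const_add γ
    rw [add_zero] at h1
    -- The two factors `T⁻¹` cancel, one standing inside the inverse and one outside; this requires
    -- `T > 0`.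
    refine h1.congr' ?_
    filter_upwards [hunit, hx, hTpos] with a ha hxa hTa
    have hT0 : (T a : ℝ) ≠ 0 := by positivity
    rw [gammaHat_eq_of_isUnit net s cl ha hxa]
    congr 1
    have h2 : ((T a : ℝ)⁻¹ • normalMatrix net s cl (T a) (x a))⁻¹ =
        (T a : ℝ) • (normalMatrix net s cl (T a) (x a))⁻¹ := by
      have h3 := Matrix.inv_smul' (normalMatrix net s cl (T a) (x a))
        (Units.mk0 ((T a : ℝ)⁻¹) (inv_ne_zero hT0)) ((Matrix.isUnit_iff_isUnit_det _).1 ha)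
      simpa [Units.smul_def] using h3
    rw [h2, Matrix.vec_smul, Matrix.mulVec_smul, Matrix.mulVec_smul, Matrix.smul_mulVec, smul_smul,
      inv_mul_cancel₀ hT0, one_smul]
  have hB := ((continuous_coeffMatrix net s cl).tendsto γ).comp hγ
  have hD : Tendsto (fun a => coeffMatrix net s cl (gammaHat net s cl (T a) (x a)) -
      coeffMatrix net s cl γ) l (𝓝 0) := by
    have := hB.sub_const (coeffMatrix net s cl γ)
    rwa [sub_self] at this
  have hc : Continuous fun q : (Matrix (Fin N) (Fin N) ℝ × Matrix (Fin N) (Fin p × Fin N) ℝ) ×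
      Matrix (Fin N) (Fin p × Fin N) ℝ × Matrix (Fin p × Fin N) (Fin p × Fin N) ℝ =>
      q.1.1 - q.1.2 * q.2.1ᵀ - q.2.1 * q.1.2ᵀ + q.2.1 * q.2.2 * q.2.1ᵀ := by fun_prop
  have hfin := (hc.tendsto _).comp ((hV.prodMk_nhds hC).prodMk_nhds (hD.prodMk_nhds hS))
  simp only [Matrix.zero_mul, Matrix.transpose_zero, Matrix.mul_zero, sub_zero, add_zero] at hfin
  refine hfin.congr' ?_
  filter_upwards [hx] with a hxa
  rw [Function.comp_apply, ← residual_mul_transpose, sigmaTilde, hxa]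
  have : ∀ (B' B : Matrix (Fin N) (Fin p × Fin N) ℝ)
      (Z : Matrix (Fin p × Fin N) (Fin (T a - p)) ℝ), B * Z + U a - B' * Z =
        U a - (B' - B) * Z := fun B' B Z => by
    rw [Matrix.sub_mul]; abel
  simp only [this]

end

/-! ### Convergence in probability as a filter, and a weak law of large numbers. -/

section

variable {Ω : Type*} [MeasurableSpace Ω]

/-- The filter of the sets of pairs `(T, w)` whose `T`-sections have a probability that tends to
one. Convergence along it is convergence in probability. -/
def probFilter (μ : Measure Ω) : Filter (ℕ × Ω) where
  sets := {S | Tendsto (fun T => μ {w | (T, w) ∉ S}) atTop (𝓝 0)}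
  univ_sets := by simp
  sets_of_superset := fun {S S'} hS h =>
    tendsto_of_tendsto_of_tendsto_of_le_of_le tendsto_const_nhds hS (fun _ => zero_le)
      fun T => measure_mono fun w hw hw' => hw (h hw')
  inter_sets := fun {S S'} hS hS' => by
    have h := Tendsto.add hS hS'
    rw [add_zero] at h
    refine tendsto_of_tendsto_of_tendsto_of_le_of_le tendsto_const_nhds h (fun _ => zero_le)
      fun T => ?_
    refine (measure_mono fun w hw => ?_).trans (measure_union_le _ _)
    simpa only [Set.mem_inter_iff, Set.mem_ofPred_eq, not_and_or, Set.mem_union] using hw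

variable {μ : Measure Ω}

theorem eventually_probFilter {P : ℕ × Ω → Prop} :
    (∀ᶠ a in probFilter μ, P a) ↔ Tendsto (fun T => μ {w | ¬ P (T, w)}) atTop (𝓝 0) :=
  Iff.rfl

theorem eventually_probFilter_of_ae {P : ℕ × Ω → Prop} (h : ∀ T, ∀ᵐ w ∂μ, P (T, w)) :
    ∀ᶠ a in probFilter μ, P a := by
  rw [eventually_probFilter]
  exact tendsto_const_nhds.congr fun T => (ae_iff.1 (h T)).symm

theorem tendsto_fst_probFilter : Tendsto Prod.fst (probFilter μ) (atTop : Filter ℕ) := by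
  refine tendsto_atTop.2 fun n => ?_
  rw [eventually_probFilter]
  refine tendsto_const_nhds.congr' ?_
  filter_upwards [eventually_ge_atTop n] with T hT
  simp [hT]

/-- This gives uniqueness of limits in probability and lets inequalities pass to them. -/
instance probFilter_neBot [IsProbabilityMeasure μ] : (probFilter μ).NeBot := by
  refine ⟨fun h => ?_⟩
  have : ∀ᶠ a in probFilter μ, False := by rw [h]; exact eventually_bot
  rw [eventually_probFilter] at this
  simp at this

theorem tendstoInMeasure_of_tendsto_probFilter {f : ℕ → Ω → ℝ} {c : ℝ}
    (h : Tendsto (fun a : ℕ × Ω => f a.1 a.2) (probFilter μ) (𝓝 c)) :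
    TendstoInMeasure μ f atTop fun _ => c := by
  intro ε hε
  have := h.eventually (Metric.eball_mem_nhds c hε)
  rw [eventually_probFilter] at this
  refine this.congr fun T => ?_
  congr 1
  ext w
  simp

theorem tendsto_measure_of_eventually_probFilter [IsProbabilityMeasure μ] {P : ℕ × Ω → Prop}
    (h : ∀ᶠ a in probFilter μ, P a) : Tendsto (fun T => μ {w | P (T, w)}) atTop (𝓝 1) := by
  rw [eventually_probFilter] at h
  have h1 : Tendsto (fun T => 1 - μ {w | ¬ P (T, w)}) atTop (𝓝 (1 - 0)) :=
    ENNReal.Tendsto.sub tendsto_const_nhds h (Or.inl ENNReal.one_ne_top)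
  rw [tsub_zero] at h1
  refine tendsto_of_tendsto_of_tendsto_of_le_of_le h1 tendsto_const_nhds (fun T => ?_)
    fun T => prob_le_one
  -- Subadditivity alone is used, so the event need not be measurable.
  rw [tsub_le_iff_right, ← measure_univ (μ := μ)]
  refine (measure_mono fun w _ => ?_).trans (measure_union_le _ _)
  exact em _

/-- Markov's inequality along `probFilter`. -/
theorem tendsto_probFilter_of_integral_le [IsFiniteMeasure μ] {f : ℕ → Ω → ℝ}
    (hf0 : ∀ T w, 0 ≤ f T w) (hfi : ∀ T, Integrable (f T) μ) {e : ℕ → ℝ}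
    (hfe : ∀ T, ∫ w, f T w ∂μ ≤ e T) (he : Tendsto e atTop (𝓝 0)) :
    Tendsto (fun a : ℕ × Ω => f a.1 a.2) (probFilter μ) (𝓝 0) := by
  rw [Metric.tendsto_nhds]
  intro ε hε
  rw [eventually_probFilter]
  have h : ∀ T, μ {w | ¬ dist (f T w) 0 < ε} ≤ ENNReal.ofReal (e T / ε) := by
    intro T
    have h1 := mul_meas_ge_le_integral_of_nonneg (ae_of_all μ (hf0 T)) (hfi T) ε
    have h2 : {w | ¬ dist (f T w) 0 < ε} = {w | ε ≤ f T w} := by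
      ext w
      simp [abs_of_nonneg (hf0 T w)]
    rw [h2, ← ofReal_measureReal]
    refine ENNReal.ofReal_le_ofReal ?_
    rw [le_div_iff₀ hε, mul_comm]
    exact h1.trans (hfe T)
  refine tendsto_of_tendsto_of_tendsto_of_le_of_le tendsto_const_nhds ?_ (fun _ => zero_le) h
  have := ENNReal.tendsto_ofReal (he.div_const ε)
  simpa using this

/-- Weak law of large numbers for orthogonal sequences with bounded second moments. -/
theorem tendsto_probFilter_sum_of_orthogonal [IsFiniteMeasure μ] {f : ℕ → Ω → ℝ} {K : ℝ}
    (p : ℕ) (hf : ∀ k, MemLp (f k) 2 μ) (hK : ∀ k, ∫ w, f k w ^ 2 ∂μ ≤ K)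
    (horth : ∀ k k', k < k' → ∫ w, f k w * f k' w ∂μ = 0) :
    Tendsto (fun a : ℕ × Ω => (a.1 : ℝ)⁻¹ * ∑ k : Fin (a.1 - p), f k a.2)
      (probFilter μ) (𝓝 0) := by
  have hint : ∀ k k', Integrable (fun w => f k w * f k' w) μ := fun k k' =>
    (hf k).integrable_mul (hf k')
  have hK0 : 0 ≤ K := (integral_nonneg fun w => sq_nonneg (f 0 w)).trans (hK 0)
  have hrowint : ∀ (T : ℕ) (k : Fin (T - p)),
      Integrable (fun w => ∑ k' : Fin (T - p), f k w * f k' w) μ := fun T k =>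
    integrable_finsetSum _ fun (k' : Fin (T - p)) _ => hint k k'
  -- In the expanded square only the at most `T` diagonal terms have nonzero mean, whence the bound
  -- `K / T`.
  have hexp : ∀ (T : ℕ) w, ((T : ℝ)⁻¹ * ∑ k : Fin (T - p), f k w) ^ 2 =
      (T : ℝ)⁻¹ ^ 2 * ∑ k : Fin (T - p), ∑ k' : Fin (T - p), f k w * f k' w := by
    intro T w
    rw [mul_pow, sq (∑ k : Fin (T - p), f k w), Finset.sum_mul_sum]
  have hsq : Tendsto (fun a : ℕ × Ω => ((a.1 : ℝ)⁻¹ * ∑ k : Fin (a.1 - p), f k a.2) ^ 2)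
      (probFilter μ) (𝓝 0) := by
    refine tendsto_probFilter_of_integral_le
      (f := fun T w => ((T : ℝ)⁻¹ * ∑ k : Fin (T - p), f k w) ^ 2) (fun _ _ => sq_nonneg _)
      (fun T => ?_) (e := fun T => K * (T : ℝ)⁻¹) (fun T => ?_) ?_
    · simp only [hexp]
      exact (integrable_finsetSum _ fun k _ => hrowint T k).const_mul _
    · simp only [hexp]
      rw [integral_const_mul, integral_finsetSum _ fun k _ => hrowint T k]
      have hrow : ∀ k : Fin (T - p), ∫ w, ∑ k' : Fin (T - p), f k w * f k' w ∂μ ≤ K := by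
        intro k
        rw [integral_finsetSum _ fun (k' : Fin (T - p)) _ => hint k k', Finset.sum_eq_single k]
        · simpa only [sq] using hK k
        · intro k' _ hne
          rcases lt_or_gt_of_ne hne with h | h
          · simpa only [mul_comm] using horth k' k h
          · exact horth k k' h
        · simp
      have h1 : ∑ k : Fin (T - p), ∫ w, ∑ k' : Fin (T - p), f k w * f k' w ∂μ ≤ T * K := by
        refine (Finset.sum_le_sum fun k _ => hrow k).trans ?_
        rw [Finset.sum_const, Finset.card_univ, Fintype.card_fin, nsmul_eq_mul]
        exact mul_le_mul_of_nonneg_right (by exact_mod_cast Nat.sub_le T p) hK0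
      refine (mul_le_mul_of_nonneg_left h1 (by positivity)).trans (le_of_eq ?_)
      rcases Nat.eq_zero_or_pos T with rfl | hT
      · simp
      · field_simp
    · have := (tendsto_inv_atTop_nhds_zero_nat (𝕜 := ℝ)).const_mul K
      simpa using this
  have := hsq.sqrt
  rw [Real.sqrt_zero] at this
  simp only [Real.sqrt_sq_eq_abs] at this
  exact (tendsto_zero_iff_abs_tendsto_zero _).2 this

end

/-! ### Solution paths and causality. -/

/-- The vector that stacks `x_t, …, x_{t-p+1}`. -/
def lagVec {N : ℕ} (p : ℕ) (x : ℤ → Fin N → ℝ) (t : ℤ) : Fin p × Fin N → ℝ :=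
  fun a => x (t - a.1.1) a.2

theorem phi_mulVec {N C p G : ℕ} (net : Network N C) (s : Fin p → ℕ) (cl : Fin N → Fin G)
    (γ : ParamIdx p G C s → ℝ) (j : Fin p) (y : Fin N → ℝ) (i : Fin N) :
    (phi net s cl γ j *ᵥ y) i = γ (Sum.inl (cl i, j)) * y i +
      ∑ c : Fin C, ∑ r : Fin (s j), γ (Sum.inr ⟨j, r, c⟩) *
        ∑ q ∈ stageNbrs net.graph i (r.1 + 1), net.ω i q c * y q := by
  have hW : ∀ r c, (net.W r c *ᵥ y) i = ∑ q ∈ stageNbrs net.graph i r, net.ω i q c * y q := by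
    intro r c
    simp [Network.W, Matrix.mulVec, dotProduct, ite_mul, Finset.sum_ite_mem]
  simp only [phi, Matrix.add_mulVec, Pi.add_apply, Matrix.mulVec_diagonal, Matrix.sum_mulVec,
    Finset.sum_apply, Matrix.smul_mulVec, Pi.smul_apply, smul_eq_mul, hW]

/-- The path `x` solves the autoregression with coefficients `φ` and innovations `e`. -/
def IsPath {N p : ℕ} (φ : Fin p → Matrix (Fin N) (Fin N) ℝ) (x e : ℤ → Fin N → ℝ) : Prop :=
  ∀ t i, x t i = ∑ j : Fin p, (φ j *ᵥ x (t - (j.1 + 1 : ℕ))) i + e t i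

theorem IsPath.lagVec_add_one {N p : ℕ} {φ : Fin p → Matrix (Fin N) (Fin N) ℝ}
    {x e : ℤ → Fin N → ℝ} (h : IsPath φ x e) (t : ℤ) :
    lagVec p x (t + 1) = companion φ *ᵥ lagVec p x t + firstBlock N p *ᵥ e (t + 1) := by
  funext a
  obtain ⟨⟨j, hj⟩, m⟩ := a
  rw [Pi.add_apply]
  cases j with
  | zero =>
    rw [companion_mulVec_zero, firstBlock_mulVec_zero]
    simp only [lagVec, Nat.cast_zero, sub_zero]
    rw [h (t + 1) m]
    congr 1
    refine Finset.sum_congr rfl fun j _ => ?_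
    have : t + 1 - ((j.1 + 1 : ℕ) : ℤ) = t - j.1 := by push_cast; ring
    rw [this]
  | succ j =>
    rw [companion_mulVec_succ, firstBlock_mulVec_succ, add_zero]
    simp only [lagVec]
    congr 1
    push_cast
    ring

theorem IsPath.lagVec_eq {N p : ℕ} {φ : Fin p → Matrix (Fin N) (Fin N) ℝ}
    {x e : ℤ → Fin N → ℝ} (h : IsPath φ x e) (t : ℤ) (n : ℕ) :
    lagVec p x t = companion φ ^ n *ᵥ lagVec p x (t - n) +
      ∑ k ∈ Finset.range n, (companion φ ^ k * firstBlock N p) *ᵥ e (t - k) := by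
  induction n with
  | zero => simp
  | succ n ih =>
    have h1 := h.lagVec_add_one (t - (n + 1 : ℕ))
    have h2 : t - ((n + 1 : ℕ) : ℤ) + 1 = t - n := by push_cast; ring
    rw [h2] at h1
    rw [Finset.sum_range_succ, pow_succ, ← Matrix.mulVec_mulVec]
    rw [h1, Matrix.mulVec_add, Matrix.mulVec_mulVec _ (companion φ ^ n) (firstBlock N p)] at ih
    rw [ih]
    abel

section

variable {N : ℕ} {Ω : Type*}

/-- The information generated by the innovations up to time `t`. -/
abbrev past (u : ℤ → Ω → Fin N → ℝ) (t : ℤ) : MeasurableSpace Ω :=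
  ⨆ r ∈ Set.Iic t, MeasurableSpace.comap (u r) inferInstance

theorem past_mono (u : ℤ → Ω → Fin N → ℝ) {t t' : ℤ} (h : t ≤ t') : past u t ≤ past u t' :=
  biSup_mono fun _ hr => le_trans (Set.mem_Iic.1 hr) h

theorem measurable_past (u : ℤ → Ω → Fin N → ℝ) {r t : ℤ} (h : r ≤ t) :
    Measurable[past u t] (u r) := by
  rw [measurable_iff_comap_le]
  exact le_biSup (fun r => MeasurableSpace.comap (u r) inferInstance) (Set.mem_Iic.2 h)

theorem measurable_past_apply (u : ℤ → Ω → Fin N → ℝ) {r t : ℤ} (h : r ≤ t) (i : Fin N) :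
    Measurable[past u t] fun w => u r w i :=
  (measurable_pi_apply i).comp (measurable_past u h)

variable [MeasurableSpace Ω] {μ : Measure Ω}

/-- Disjoint sets of times generate independent σ-algebras; a past-measurable version of `f`
replaces `f` itself. -/
theorem indepFun_of_past {u : ℤ → Ω → Fin N → ℝ} (hum : ∀ t, Measurable (u t))
    (hu : iIndepFun u μ) {f : Ω → ℝ} {t t' : ℤ} (hf : AEStronglyMeasurable[past u t] f μ)
    (ht : t < t') (i : Fin N) : IndepFun f (fun w => u t' w i) μ := by
  have hind : Indep (past u t)
      (⨆ r ∈ ({t'} : Set ℤ), MeasurableSpace.comap (u r) inferInstance) μ := by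
    refine indep_iSup_of_disjoint (fun r => (hum r).comap_le) hu.iIndep ?_
    rw [Set.disjoint_singleton_right, Set.mem_Iic]
    omega
  obtain ⟨g, hg, hfg⟩ := hf
  refine IndepFun.congr ?_ hfg.symm (ae_eq_refl _)
  rw [IndepFun_iff_Indep]
  refine indep_of_indep_of_le_left (indep_of_indep_of_le_right hind ?_) hg.measurable.comap_le
  rw [← measurable_iff_comap_le]
  refine (measurable_pi_apply i).comp ?_
  rw [measurable_iff_comap_le]
  exact le_biSup (fun r => MeasurableSpace.comap (u r) inferInstance) (Set.mem_singleton t')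

/-- Independence factors the second moment of the product, so no fourth moments of the observations
are needed. -/
theorem memLp_two_mul_of_indepFun {f g : Ω → ℝ} (hf : MemLp f 2 μ) (hg : MemLp g 2 μ)
    (h : IndepFun f g μ) : MemLp (fun w => f w * g w) 2 μ ∧
      ∫ w, (f w * g w) ^ 2 ∂μ = (∫ w, f w ^ 2 ∂μ) * ∫ w, g w ^ 2 ∂μ := by
  have h2 : IndepFun (fun w => f w ^ 2) (fun w => g w ^ 2) μ :=
    h.comp (measurable_id.pow_const 2) (measurable_id.pow_const 2)
  simp only [mul_pow]
  refine ⟨?_, h2.integral_fun_mul_eq_mul_integral hf.integrable_sq.1 hg.integrable_sq.1⟩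
  refine (memLp_two_iff_integrable_sq (hf.1.mul hg.1)).2 ?_
  simp only [Pi.mul_apply, mul_pow]
  exact h2.integrable_mul hf.integrable_sq hg.integrable_sq

theorem IsStationary.exists_integral_sq_le [IsProbabilityMeasure μ] {X : ℤ → Ω → Fin N → ℝ}
    (hX : IsStationary μ X) : ∃ K : ℝ, ∀ t i, ∫ w, X t w i ^ 2 ∂μ ≤ K := by
  refine ⟨∑ i, ∫ w, X 0 w i ^ 2 ∂μ, fun t i => ?_⟩
  have h : ∀ t, ∫ w, X t w i ^ 2 ∂μ =
      covariance (fun w => X t w i) (fun w => X t w i) μ + (∫ w, X t w i ∂μ) ^ 2 := by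
    intro t
    rw [covariance_eq_sub (hX.memLp t i) (hX.memLp t i)]
    simp only [Pi.mul_apply, ← sq]
    ring
  have hc := hX.cov t 0 i i
  rw [add_zero] at hc
  rw [h t, hc, hX.mean t i, ← h 0]
  exact Finset.single_le_sum (f := fun i => ∫ w, X 0 w i ^ 2 ∂μ)
    (fun i _ => integral_nonneg fun w => sq_nonneg _) (Finset.mem_univ i)

/-- Causality: a stable autoregression with bounded second moments is a function of the past
innovations. -/
theorem aestronglyMeasurable_past_lagVec [IsProbabilityMeasure μ] {p : ℕ}
    {φ : Fin p → Matrix (Fin N) (Fin N) ℝ} (hφ : IsStable φ) {X u : ℤ → Ω → Fin N → ℝ}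
    (hX : ∀ t i, MemLp (fun w => X t w i) 2 μ) {K : ℝ} (hK : ∀ t i, ∫ w, X t w i ^ 2 ∂μ ≤ K)
    (hpath : ∀ᵐ w ∂μ, IsPath φ (fun t => X t w) (fun t => u t w)) (t : ℤ) (a : Fin p × Fin N) :
    AEStronglyMeasurable[past u t] (fun w => lagVec p (fun t => X t w) t a) μ := by
  let A := companion φ
  let V : ℕ → Ω → ℝ := fun n w =>
    (∑ k ∈ Finset.range n, (A ^ k * firstBlock N p) *ᵥ u (t - k) w) a
  -- `D n` dominates the remainder `A ^ n Z_{t-n}` left after unrolling the recursion `n` times; its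
  -- mean vanishes since `A ^ n → 0` while first moments stay bounded.
  let D : ℕ → Ω → ℝ := fun n w => ∑ b, |(A ^ n) a b| * |lagVec p (fun t => X t w) (t - n) b|
  have hVm : ∀ n, Measurable[past u t] (V n) := by
    intro n
    simp only [V, Finset.sum_apply, Matrix.mulVec, dotProduct]
    refine Finset.measurable_sum _ fun k _ => Finset.measurable_sum _ fun b _ => ?_
    exact (measurable_past_apply u (by omega) b).const_mul _
  have hint : ∀ t i, Integrable (fun w => |X t w i|) μ := fun t i =>
    ((hX t i).integrable one_le_two).abs
  have habs : ∀ t i, ∫ w, |X t w i| ∂μ ≤ 1 + K := by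
    intro t i
    have : ∫ w, |X t w i| ∂μ ≤ ∫ w, (1 + X t w i ^ 2) ∂μ := by
      refine integral_mono (hint t i) ((integrable_const _).add (hX t i).integrable_sq) fun w => ?_
      have := sq_abs (X t w i)
      change |X t w i| ≤ 1 + X t w i ^ 2
      nlinarith [sq_nonneg (|X t w i| - 1), abs_nonneg (X t w i)]
    refine this.trans ?_
    rw [integral_add (integrable_const _) (hX t i).integrable_sq]
    simpa using hK t i
  have hD : Tendsto (fun q : ℕ × Ω => D q.1 q.2) (probFilter μ) (𝓝 0) := by
    refine tendsto_probFilter_of_integral_le (f := D)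
      (fun n w => Finset.sum_nonneg fun b _ => mul_nonneg (abs_nonneg _) (abs_nonneg _))
      (fun n => integrable_finsetSum _ fun b _ => (hint _ _).const_mul _)
      (e := fun n => ∑ b, |(A ^ n) a b| * (1 + K)) (fun n => ?_) ?_
    · change ∫ w, ∑ b : Fin p × Fin N, |(A ^ n) a b| * |X (t - n - b.1.1) w b.2| ∂μ ≤ _
      rw [integral_finsetSum _ fun b _ => (hint _ _).const_mul _]
      refine Finset.sum_le_sum fun b _ => ?_
      rw [integral_const_mul]
      exact mul_le_mul_of_nonneg_left (habs _ _) (abs_nonneg _)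
    · have h0 := hφ.tendsto_companion_pow
      have h1 : ∀ b, Tendsto (fun n => |(A ^ n) a b| * (1 + K)) atTop (𝓝 0) := by
        intro b
        have hc : Continuous fun M : Matrix (Fin p × Fin N) (Fin p × Fin N) ℝ => M a b :=
          continuous_id.matrix_elem a b
        have := (((hc.tendsto 0).comp h0).abs).mul_const (1 + K)
        simpa using this
      have := tendsto_finsetSum Finset.univ fun b _ => h1 b
      simpa using this
  obtain ⟨ns, hns, hlim⟩ := (tendstoInMeasure_of_tendsto_probFilter hD).exists_seq_tendsto_ae
  -- Convergence in probability gives almost sure convergence only along `ns`. The upper limit is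
  -- defined everywhere and past-measurable, and agrees almost surely with the limit.
  refine ⟨fun w => limsup (fun k => V (ns k) w) atTop,
    (Measurable.limsup fun k => hVm (ns k)).stronglyMeasurable, ?_⟩
  filter_upwards [hlim, hpath] with w hw hp
  refine (Tendsto.limsup_eq ?_).symm
  have hle : ∀ n, ‖V n w - lagVec p (fun t => X t w) t a‖ ≤ D n w := by
    intro n
    have h1 := congrFun (hp.lagVec_eq t n) a
    rw [Pi.add_apply] at h1
    have h2 : V n w - lagVec p (fun t => X t w) t a =
        -((A ^ n *ᵥ lagVec p (fun t => X t w) (t - n)) a) := by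
      rw [h1]
      simp only [V, A]
      ring
    rw [h2, norm_neg, Real.norm_eq_abs, Matrix.mulVec, dotProduct]
    refine (Finset.abs_sum_le_sum_abs _ _).trans (le_of_eq ?_)
    simp only [abs_mul, D]
  rw [tendsto_iff_norm_sub_tendsto_zero]
  exact squeeze_zero (fun k => norm_nonneg _) (fun k => hle (ns k)) hw

end

/-! ### Limits of the sample moments. -/

section

variable {N : ℕ} {Ω : Type*} [MeasurableSpace Ω] {μ : Measure Ω}

theorem IsIndepWhiteNoise.memLp_two [IsFiniteMeasure μ] {u : ℤ → Ω → Fin N → ℝ}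
    {S : Matrix (Fin N) (Fin N) ℝ} (hu : IsIndepWhiteNoise μ u S) (t : ℤ) (i : Fin N) :
    MemLp (fun w => u t w i) 2 μ :=
  (hu.memLp t i).mono_exponent (by norm_num)

theorem IsIndepWhiteNoise.integral_sq {u : ℤ → Ω → Fin N → ℝ}
    {S : Matrix (Fin N) (Fin N) ℝ} (hu : IsIndepWhiteNoise μ u S) (t : ℤ) (i : Fin N) :
    ∫ w, u t w i ^ 2 ∂μ = S i i := by
  simpa only [sq] using hu.cov t i i

/-- Sample covariances of the innovations and predetermined regressors vanish asymptotically. -/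
theorem tendsto_sum_innovation_mul_predetermined [IsProbabilityMeasure μ]
    {u : ℤ → Ω → Fin N → ℝ} {S : Matrix (Fin N) (Fin N) ℝ} (hu : IsIndepWhiteNoise μ u S)
    {Y : ℤ → Ω → ℝ} (hY : ∀ t, MemLp (Y t) 2 μ) {K : ℝ} (hK : ∀ t, ∫ w, Y t w ^ 2 ∂μ ≤ K)
    (hpast : ∀ t, AEStronglyMeasurable[past u t] (Y t) μ) (p : ℕ) (i : Fin N) :
    Tendsto (fun a : ℕ × Ω =>
      (a.1 : ℝ)⁻¹ * ∑ k : Fin (a.1 - p), u ((p : ℤ) + 1 + k.1) a.2 i * Y ((p : ℤ) + k.1) a.2)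
      (probFilter μ) (𝓝 0) := by
  have hind : ∀ {f : Ω → ℝ} {t t' : ℤ}, AEStronglyMeasurable[past u t] f μ → t < t' →
      IndepFun f (fun w => u t' w i) μ := fun hf ht =>
    indepFun_of_past hu.measurable hu.indep hf ht i
  have hmul : ∀ k : ℕ, MemLp (fun w => Y ((p : ℤ) + k) w * u ((p : ℤ) + 1 + k) w i) 2 μ ∧
      ∫ w, (Y ((p : ℤ) + k) w * u ((p : ℤ) + 1 + k) w i) ^ 2 ∂μ =
        (∫ w, Y ((p : ℤ) + k) w ^ 2 ∂μ) * ∫ w, u ((p : ℤ) + 1 + k) w i ^ 2 ∂μ := fun k =>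
    memLp_two_mul_of_indepFun (hY _) (hu.memLp_two _ i) (hind (hpast _) (by omega))
  have hSi : 0 ≤ S i i := by
    rw [← hu.integral_sq 0 i]
    exact integral_nonneg fun w => sq_nonneg _
  refine tendsto_probFilter_sum_of_orthogonal
    (f := fun k w => u ((p : ℤ) + 1 + k) w i * Y ((p : ℤ) + k) w) (K := K * S i i) p
    (fun k => ?_) (fun k => ?_) fun k k' hk => ?_
  · simpa only [mul_comm] using (hmul k).1
  · simp only [mul_comm (u _ _ i)]
    rw [(hmul k).2, hu.integral_sq]
    exact mul_le_mul_of_nonneg_right (hK _) hSi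
  -- As `k < k'`, time `p + 1 + k` is at most `p + k'`: every factor except the later innovation
  -- belongs to the past at `p + k'`, and that innovation is independent of it with mean zero.
  · have hg : AEStronglyMeasurable[past u ((p : ℤ) + k')]
        (fun w => u ((p : ℤ) + 1 + k) w i * Y ((p : ℤ) + k) w * Y ((p : ℤ) + k') w) μ := by
      refine AEStronglyMeasurable.mul (AEStronglyMeasurable.mul ?_ ?_) (hpast _)
      · exact (measurable_past_apply u (by omega) i).stronglyMeasurable.aestronglyMeasurable
      · exact (hpast _).mono (past_mono u (by omega))
    have h0 := (hind hg (show (p : ℤ) + k' < p + 1 + k' by omega)).integral_fun_mul_eq_mul_integral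
      ?_ (hu.memLp_two _ i).1
    · rw [hu.mean, mul_zero] at h0
      rw [← h0]
      refine integral_congr_ae (ae_of_all _ fun w => ?_)
      ring
    · exact ((hu.memLp_two _ i).1.mul (hY _).1).mul (hY _).1

/-- Law of large numbers for the sample covariance of the innovations. -/
theorem tendsto_sum_innovation_mul_innovation [IsProbabilityMeasure μ]
    {u : ℤ → Ω → Fin N → ℝ} {S : Matrix (Fin N) (Fin N) ℝ} (hu : IsIndepWhiteNoise μ u S)
    (p : ℕ) (i j : Fin N) :
    Tendsto (fun a : ℕ × Ω => (a.1 : ℝ)⁻¹ *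
      ∑ k : Fin (a.1 - p), u ((p : ℤ) + 1 + k.1) a.2 i * u ((p : ℤ) + 1 + k.1) a.2 j)
      (probFilter μ) (𝓝 (S i j)) := by
  obtain ⟨K, hK⟩ := hu.bound
  have h4 : ∀ t i, Integrable (fun w => u t w i ^ 4) μ := by
    intro t i
    have := (hu.memLp t i).integrable_norm_pow (p := 4) (by norm_num)
    refine this.congr (ae_of_all _ fun w => ?_)
    exact Even.pow_abs (by decide) _
  -- Fourth moments enter here: they bound the variance of a product of two components, which may be
  -- dependent.
  have hle : ∀ t w, (u t w i * u t w j) ^ 2 ≤ (u t w i ^ 4 + u t w j ^ 4) / 2 := fun t w => by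
    nlinarith [sq_nonneg (u t w i ^ 2 - u t w j ^ 2)]
  have hm : ∀ t, AEStronglyMeasurable (fun w => u t w i * u t w j) μ := fun t =>
    (hu.memLp t i).1.mul (hu.memLp t j).1
  have hbd : ∀ t, Integrable (fun w => (u t w i ^ 4 + u t w j ^ 4) / 2) μ := fun t =>
    ((h4 t i).add (h4 t j)).div_const 2
  have hsq : ∀ t, Integrable (fun w => (u t w i * u t w j) ^ 2) μ := by
    intro t
    refine (hbd t).mono' ((hm t).pow 2) (ae_of_all _ fun w => ?_)
    rw [Real.norm_eq_abs, abs_of_nonneg (sq_nonneg _)]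
    exact hle t w
  have hL2 : ∀ t, MemLp (fun w => u t w i * u t w j) 2 μ := fun t =>
    (memLp_two_iff_integrable_sq (hm t)).2 (hsq t)
  have hcL2 : ∀ t, MemLp (fun w => u t w i * u t w j - S i j) 2 μ := fun t =>
    (hL2 t).sub (memLp_const _)
  have hc0 : ∀ t, ∫ w, (u t w i * u t w j - S i j) ∂μ = 0 := by
    intro t
    rw [integral_sub ((hL2 t).integrable one_le_two) (integrable_const _), hu.cov]
    simp
  have hcent : Tendsto (fun a : ℕ × Ω => (a.1 : ℝ)⁻¹ * ∑ k : Fin (a.1 - p),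
      (u ((p : ℤ) + 1 + k.1) a.2 i * u ((p : ℤ) + 1 + k.1) a.2 j - S i j))
      (probFilter μ) (𝓝 0) := by
    refine tendsto_probFilter_sum_of_orthogonal
      (f := fun k w => u ((p : ℤ) + 1 + k) w i * u ((p : ℤ) + 1 + k) w j - S i j)
      (K := K) p (fun k => hcL2 _) (fun k => ?_) fun k k' hk => ?_
    · set t : ℤ := (p : ℤ) + 1 + k
      have h1 : ∫ w, (u t w i * u t w j - S i j) ^ 2 ∂μ =
          ∫ w, (u t w i * u t w j) ^ 2 ∂μ - S i j ^ 2 := by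
        have : ∀ w, (u t w i * u t w j - S i j) ^ 2 = (u t w i * u t w j) ^ 2 -
            (2 * S i j * (u t w i * u t w j - S i j) + S i j ^ 2) := fun w => by ring
        simp only [this]
        have hi : Integrable (fun w => 2 * S i j * (u t w i * u t w j - S i j)) μ :=
          ((hcL2 t).integrable one_le_two).const_mul _
        have hi' : Integrable
            (fun w => 2 * S i j * (u t w i * u t w j - S i j) + S i j ^ 2) μ :=
          hi.add (integrable_const _)
        rw [integral_sub (hsq t) hi',
          integral_add hi (integrable_const _), integral_const_mul, hc0]
        simp
      have h2 : ∫ w, (u t w i * u t w j) ^ 2 ∂μ ≤ (K + K) / 2 := by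
        refine (integral_mono (hsq t) (hbd t) (hle t)).trans ?_
        rw [integral_div, integral_add (h4 t i) (h4 t j)]
        linarith [hK t i, hK t j]
      rw [h1]
      linarith [sq_nonneg (S i j)]
    · have hmeas : Measurable fun y : Fin N → ℝ => y i * y j - S i j := by fun_prop
      have hind : IndepFun (fun w => u ((p : ℤ) + 1 + k) w i * u ((p : ℤ) + 1 + k) w j - S i j)
          (fun w => u ((p : ℤ) + 1 + k') w i * u ((p : ℤ) + 1 + k') w j - S i j) μ :=
        (hu.indep.indepFun (show (p : ℤ) + 1 + k ≠ p + 1 + k' by omega)).comp hmeas hmeas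
      rw [hind.integral_fun_mul_eq_mul_integral (hcL2 _).1 (hcL2 _).1, hc0, zero_mul]
  -- There are `T - p` summands but the divisor is `T`, so centring removes `(1 - p / T) S i j`.
  have hone : Tendsto (fun T : ℕ => S i j - (p : ℝ) * (T : ℝ)⁻¹ * S i j) atTop (𝓝 (S i j)) := by
    have := (((tendsto_inv_atTop_nhds_zero_nat (𝕜 := ℝ)).const_mul (p : ℝ)).mul_const
      (S i j)).const_sub (S i j)
    simpa using this
  have hsum := hcent.add (hone.comp tendsto_fst_probFilter)
  rw [zero_add] at hsum
  refine hsum.congr' ?_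
  filter_upwards [tendsto_fst_probFilter.eventually (eventually_gt_atTop p)] with a ha
  have ha0 : (a.1 : ℝ) ≠ 0 := by
    have : 0 < a.1 := by omega
    positivity
  rw [Finset.sum_sub_distrib, Finset.sum_const, Finset.card_univ, Fintype.card_fin, nsmul_eq_mul,
    Nat.cast_sub ha.le, Function.comp_apply]
  field_simp
  ring

/-- Products of two observations are negligible compared with the sample size. -/
theorem tendsto_inv_mul_mul [IsProbabilityMeasure μ] {Y : ℤ → Fin N → Ω → ℝ}
    (hY : ∀ t i, MemLp (Y t i) 2 μ) {K : ℝ} (hK : ∀ t i, ∫ w, Y t i w ^ 2 ∂μ ≤ K)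
    (τ τ' : ℕ → ℤ) (i j : Fin N) :
    Tendsto (fun a : ℕ × Ω => (a.1 : ℝ)⁻¹ * (Y (τ a.1) i a.2 * Y (τ' a.1) j a.2))
      (probFilter μ) (𝓝 0) := by
  have hsq : ∀ (τ : ℕ → ℤ) i, Tendsto (fun a : ℕ × Ω => (a.1 : ℝ)⁻¹ * Y (τ a.1) i a.2 ^ 2)
      (probFilter μ) (𝓝 0) := by
    intro τ i
    refine tendsto_probFilter_of_integral_le (f := fun T w => (T : ℝ)⁻¹ * Y (τ T) i w ^ 2)
      (fun T w => by positivity) (fun T => (hY _ i).integrable_sq.const_mul _)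
      (e := fun T => (T : ℝ)⁻¹ * K) (fun T => ?_) ?_
    · rw [integral_const_mul]
      exact mul_le_mul_of_nonneg_left (hK _ i) (by positivity)
    · have := (tendsto_inv_atTop_nhds_zero_nat (𝕜 := ℝ)).mul_const K
      simpa using this
  have h := (hsq τ i).add (hsq τ' j)
  rw [add_zero] at h
  refine squeeze_zero_norm (fun a => ?_) h
  rw [norm_mul, Real.norm_eq_abs, Real.norm_eq_abs, abs_of_nonneg (by positivity), ← mul_add]
  refine mul_le_mul_of_nonneg_left ?_ (by positivity)
  rw [abs_le]
  constructor <;> nlinarith [sq_nonneg (Y (τ a.1) i a.2 + Y (τ' a.1) j a.2),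
    sq_nonneg (Y (τ a.1) i a.2 - Y (τ' a.1) j a.2), sq_nonneg (Y (τ a.1) i a.2),
    sq_nonneg (Y (τ' a.1) j a.2)]

end

/-- Sample second moments of a solution path satisfy the Lyapunov equation up to sample
cross-covariances and boundary terms. -/
theorem IsPath.lyapunov {N p : ℕ} {φ : Fin p → Matrix (Fin N) (Fin N) ℝ} {x e : ℤ → Fin N → ℝ}
    (h : IsPath φ x e) (T : ℕ) (c : ℝ) :
    c • (dataZ p T x * (dataZ p T x)ᵀ) -
        companion φ * (c • (dataZ p T x * (dataZ p T x)ᵀ)) * (companion φ)ᵀ =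
      firstBlock N p * (c • (dataX p T e * (dataX p T e)ᵀ)) * (firstBlock N p)ᵀ +
      (firstBlock N p * (c • (dataX p T e * (dataZ p T x)ᵀ)) * (companion φ)ᵀ +
        companion φ * (c • (dataX p T e * (dataZ p T x)ᵀ))ᵀ * (firstBlock N p)ᵀ) -
      (Matrix.of fun a b =>
        c * (x ((p : ℤ) + (T - p : ℕ) - a.1.1) a.2 * x ((p : ℤ) + (T - p : ℕ) - b.1.1) b.2) -
          c * (x ((p : ℤ) - a.1.1) a.2 * x ((p : ℤ) - b.1.1) b.2)) := by
  set A := companion φ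
  set F := firstBlock N p
  set Z := dataZ p T x with hZ
  set E := dataX p T e with hE
  -- The regressor matrix advanced by one time unit is `A Z + F E`; its Gram matrix differs from
  -- that of `Z` only by the two end terms of a telescoping sum.
  have h1 : (Matrix.of fun a (k : Fin (T - p)) => lagVec p x ((p : ℤ) + k.1 + 1) a) =
      A * Z + F * E := by
    ext a k
    rw [Matrix.of_apply, h.lagVec_add_one]
    have : (p : ℤ) + k.1 + 1 = p + 1 + k.1 := by ring
    rw [this]
    rfl
  have h2 : (A * Z + F * E) * (A * Z + F * E)ᵀ - Z * Zᵀ = Matrix.of fun a b =>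
      x ((p : ℤ) + (T - p : ℕ) - a.1.1) a.2 * x ((p : ℤ) + (T - p : ℕ) - b.1.1) b.2 -
          x ((p : ℤ) - a.1.1) a.2 * x ((p : ℤ) - b.1.1) b.2 := by
    rw [← h1]
    ext a b
    let g : ℕ → ℝ := fun k => lagVec p x ((p : ℤ) + k) a * lagVec p x ((p : ℤ) + k) b
    have hg := Finset.sum_range_sub g (T - p)
    rw [← Fin.sum_univ_eq_sum_range (fun k => g (k + 1) - g k)] at hg
    rw [Matrix.sub_apply, Matrix.mul_apply, Matrix.mul_apply, ← Finset.sum_sub_distrib,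
      Matrix.of_apply]
    refine Eq.trans (Finset.sum_congr rfl fun k _ => ?_) (hg.trans ?_)
    · simp only [g, hZ, dataZ, lagVec, Matrix.of_apply, Matrix.transpose_apply, Nat.cast_add,
        Nat.cast_one, add_assoc]
    · simp [g, lagVec]
  have h3 : (Matrix.of fun a b : Fin p × Fin N =>
        c * (x ((p : ℤ) + (T - p : ℕ) - a.1.1) a.2 * x ((p : ℤ) + (T - p : ℕ) - b.1.1) b.2) -
          c * (x ((p : ℤ) - a.1.1) a.2 * x ((p : ℤ) - b.1.1) b.2)) =
      c • ((A * Z + F * E) * (A * Z + F * E)ᵀ - Z * Zᵀ) := by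
    rw [h2]
    ext a b
    simp [mul_sub]
  rw [h3]
  simp only [Matrix.transpose_add, Matrix.transpose_mul, Matrix.add_mul, Matrix.mul_add,
    Matrix.transpose_smul, Matrix.transpose_transpose, Matrix.mul_smul, Matrix.smul_mul,
    Matrix.mul_assoc, smul_sub, smul_add]
  abel

/-! ### From the model equations to the theorem. -/

theorem IsStationaryGNAR.ae_isPath {N C p G : ℕ} {net : Network N C} {s : Fin p → ℕ}
    {cl : Fin N → Fin G} {γ : ParamIdx p G C s → ℝ} {Ω : Type*} [MeasurableSpace Ω]
    {μ : Measure Ω} {X u : ℤ → Ω → Fin N → ℝ} (hX : IsStationaryGNAR net s cl γ μ X u) :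
    ∀ᵐ w ∂μ, IsPath (phi net s cl γ) (fun t => X t w) (fun t => u t w) := by
  have h : ∀ᵐ w ∂μ, ∀ t i, _ := ae_all_iff.2 fun t => ae_all_iff.2 fun i => hX.eqn t i
  filter_upwards [h] with w hw t i
  simp only [phi_mulVec]
  exact hw t i

theorem IsPath.dataX_eq {N C p G : ℕ} {net : Network N C} {s : Fin p → ℕ}
    {cl : Fin N → Fin G} {γ : ParamIdx p G C s → ℝ} {x e : ℤ → Fin N → ℝ}
    (h : IsPath (phi net s cl γ) x e) (T : ℕ) :
    dataX p T x = coeffMatrix net s cl γ * dataZ p T x + dataX p T e := by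
  ext i k
  rw [Matrix.add_apply, Matrix.mul_apply, Fintype.sum_prod_type]
  simp only [dataX, dataZ, coeffMatrix, Matrix.of_apply]
  rw [h]
  congr 1
  refine Finset.sum_congr rfl fun j _ => ?_
  have : (p : ℤ) + 1 + k.1 - ((j.1 + 1 : ℕ) : ℤ) = p + k.1 - j.1 := by push_cast; ring
  rw [this]
  rfl

end GNAR

theorem mainTheorem3 {N C p G : ℕ} (net : GNAR.Network N C) (s : Fin p → ℕ)
    (cl : Fin N → Fin G) (γ : GNAR.ParamIdx p G C s → ℝ)
    {Ω : Type*} [MeasurableSpace Ω] (μ : Measure Ω) [IsProbabilityMeasure μ]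
    (X u : ℤ → Ω → Fin N → ℝ) (Sigma_u : Matrix (Fin N) (Fin N) ℝ)
    (hu : GNAR.IsIndepWhiteNoise μ u Sigma_u)
    (hX : GNAR.IsStationaryGNAR net s cl γ μ X u)
    (hSigma : Sigma_u.PosDef)
    (hR : (GNAR.constraintMatrix net s cl).rank = Fintype.card (GNAR.ParamIdx p G C s)) :
    Tendsto (fun T : ℕ => μ {w | IsUnit (GNAR.normalMatrix net s cl T (fun t => X t w))})
        atTop (𝓝 1) ∧
      ∀ i k : Fin N, TendstoInMeasure μ
        (fun (T : ℕ) (w : Ω) => GNAR.sigmaTilde net s cl T (fun t => X t w) i k)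
        atTop (fun _ => Sigma_u i k) := by
  open GNAR in
  obtain ⟨K, hK⟩ := hX.stationary.exists_integral_sq_le
  have hL2 := hX.stationary.memLp
  have hpath : ∀ᶠ a in probFilter μ, IsPath (phi net s cl γ) (fun t => X t a.2)
      (fun t => u t a.2) := eventually_probFilter_of_ae fun _ => hX.ae_isPath
  have hV : Tendsto (fun a : ℕ × Ω => (a.1 : ℝ)⁻¹ • (dataX p a.1 (fun t => u t a.2) *
      (dataX p a.1 (fun t => u t a.2))ᵀ)) (probFilter μ) (𝓝 Sigma_u) := by
    refine tendsto_pi_nhds.2 fun i => tendsto_pi_nhds.2 fun j => ?_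
    exact tendsto_sum_innovation_mul_innovation hu p i j
  have hC : Tendsto (fun a : ℕ × Ω => (a.1 : ℝ)⁻¹ • (dataX p a.1 (fun t => u t a.2) *
      (dataZ p a.1 (fun t => X t a.2))ᵀ)) (probFilter μ) (𝓝 0) := by
    refine tendsto_pi_nhds.2 fun i => tendsto_pi_nhds.2 fun b => ?_
    exact tendsto_sum_innovation_mul_predetermined hu
      (Y := fun t w => lagVec p (fun t => X t w) t b) (fun t => hL2 _ _) (fun t => hK _ _)
      (fun t => aestronglyMeasurable_past_lagVec hX.stable hL2 hK hX.ae_isPath t b) p i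
  have hE : Tendsto (fun a : ℕ × Ω => (Matrix.of fun b b' : Fin p × Fin N =>
      (a.1 : ℝ)⁻¹ * (X ((p : ℤ) + (a.1 - p : ℕ) - b.1.1) a.2 b.2 *
        X ((p : ℤ) + (a.1 - p : ℕ) - b'.1.1) a.2 b'.2) -
      (a.1 : ℝ)⁻¹ * (X ((p : ℤ) - b.1.1) a.2 b.2 * X ((p : ℤ) - b'.1.1) a.2 b'.2)))
      (probFilter μ) (𝓝 0) := by
    refine tendsto_pi_nhds.2 fun b => tendsto_pi_nhds.2 fun b' => ?_
    have h := fun τ τ' => tendsto_inv_mul_mul (Y := fun t i w => X t w i) hL2 hK τ τ' b.2 b'.2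
    have h2 := (h (fun T => (p : ℤ) + (T - p : ℕ) - b.1.1)
      (fun T => (p : ℤ) + (T - p : ℕ) - b'.1.1)).sub
      (h (fun _ => (p : ℤ) - b.1.1) (fun _ => (p : ℤ) - b'.1.1))
    rw [sub_zero] at h2
    exact h2
  -- Cross-covariances and end terms vanish, leaving only the innovation covariance in the first
  -- block.
  have hlyap : Tendsto (fun a : ℕ × Ω =>
      (a.1 : ℝ)⁻¹ • (dataZ p a.1 (fun t => X t a.2) * (dataZ p a.1 (fun t => X t a.2))ᵀ) -
        companion (phi net s cl γ) * ((a.1 : ℝ)⁻¹ • (dataZ p a.1 (fun t => X t a.2) *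
          (dataZ p a.1 (fun t => X t a.2))ᵀ)) * (companion (phi net s cl γ))ᵀ)
      (probFilter μ) (𝓝 (firstBlock N p * Sigma_u * (firstBlock N p)ᵀ)) := by
    have hc : Continuous fun q : (Matrix (Fin N) (Fin N) ℝ × Matrix (Fin N) (Fin p × Fin N) ℝ) ×
        Matrix (Fin p × Fin N) (Fin p × Fin N) ℝ =>
        firstBlock N p * q.1.1 * (firstBlock N p)ᵀ +
          (firstBlock N p * q.1.2 * (companion (phi net s cl γ))ᵀ +
            companion (phi net s cl γ) * q.1.2ᵀ * (firstBlock N p)ᵀ) - q.2 := by fun_prop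
    have h := (hc.tendsto _).comp ((hV.prodMk_nhds hC).prodMk_nhds hE)
    simp only [Matrix.mul_zero, Matrix.zero_mul, Matrix.transpose_zero, add_zero, sub_zero] at h
    refine h.congr' ?_
    filter_upwards [hpath] with a ha
    exact (ha.lyapunov a.1 _).symm
  obtain ⟨Γ, hΓ, hS⟩ := exists_tendsto_of_lyapunov hX.stable.tendsto_companion_pow hlyap
  -- `Γ` inherits symmetry and nonnegativity from the Gram matrices converging to it; the Lyapunov
  -- equation then upgrades this to definiteness.
  have hpsd : Γ.PosSemidef := by
    have hS' : ∀ a : ℕ × Ω, ((a.1 : ℝ)⁻¹ • (dataZ p a.1 (fun t => X t a.2) *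
        (dataZ p a.1 (fun t => X t a.2))ᵀ)).PosSemidef := fun a =>
      (Matrix.posSemidef_self_mul_conjTranspose (dataZ p a.1 fun t => X t a.2)).smul
        (by positivity)
    refine Matrix.PosSemidef.of_dotProduct_mulVec_nonneg ?_ fun v => ?_
    · refine tendsto_nhds_unique ?_ hS
      refine ((continuous_id.matrix_conjTranspose.tendsto Γ).comp hS).congr fun a => ?_
      exact (hS' a).1
    · have hc : Continuous fun M : Matrix (Fin p × Fin N) (Fin p × Fin N) ℝ =>
          star v ⬝ᵥ (M *ᵥ v) := by fun_prop
      exact ge_of_tendsto' ((hc.tendsto Γ).comp hS) fun a => (hS' a).dotProduct_mulVec_nonneg v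
  obtain ⟨h1, h2⟩ := isUnit_normalMatrix_and_tendsto_sigmaTilde net s cl hR
    tendsto_fst_probFilter (hpath.mono fun a ha => ha.dataX_eq a.1)
    (posDef_of_companion_lyapunov hpsd hSigma hΓ) hS hC hV
  refine ⟨tendsto_measure_of_eventually_probFilter h1, fun i k => ?_⟩
  exact tendstoInMeasure_of_tendsto_probFilter (tendsto_pi_nhds.1 (tendsto_pi_nhds.1 h2 i) k)
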